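/- For finite sets $s,t\subset\mathbb N$ write $s<t$ if $a<b$ for all $a\in s$, $b\in t$ (so $\emptyset<t$ and $s<\emptyset$ always hold), and write $s<n$ for $s<\{n\}$. Write $s\sqsubseteq A$ if $s$ is an initial segment of $A\subseteq\mathbb N$, i.e. $s=\{m\in A: m<n\}$ for some $n\in\mathbb N$, and $s<_{lex}t$ if $s\ne t$ and $\min(s\triangle t)\in s$. For a family $\mathcal F$ of finite subsets of $\mathbb N$, a finite set $u$ and $M\subseteq\mathbb N$ put $\mathcal F_u=\{s: u\cup s\in\mathcal F,\ u<s\}$, $M/u=\{m\in M: u<m\}$, $\mathcal F\upharpoonright M=\{s\in\mathcal F: s\subseteq M\}$ and $\overline{\mathcal F}=\{s: s\sqsubseteq t\text{ for some }t\in\mathcal F\}$. For an infinite set $M\subseteq\mathbb N$, $\alpha$-uniform families on $M$ are defined by recursion on the ordinal $\alpha$. The only $0$-uniform family on $M$ is $\{\emptyset\}$. For $\alpha>0$, a family $\mathcal F$ of nonempty finite subsets of $M$ is $\alpha$-uniform on $M$ if either $\alpha=\beta+1$ and $\mathcal F_{\{n\}}$ is $\beta$-uniform on $M/\{n\}$ for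 all $n\in M$, or $\alpha$ is a limit ordinal and there is a strictly increasing sequence of ordinals $(\alpha_n)_{n\in M}$ with supremum $\alpha$ such that $\mathcal F_{\{n\}}$ is $\alpha_n$-uniform on $M/\{n\}$ for all $n\in M$. Let $S$ be a final segment $\{k,k+1,k+2,\dots\}$ of $\mathbb N$ and let $\mathcal F$ be an $\alpha$-uniform family on $S$, where $\alpha>\omega$ is an indecomposable ordinal (there are no $\beta,\gamma<\alpha$ with $\alpha=\beta+\gamma$). Consider $\mathcal F$ as a topological space with the order topology of $<_{lex}$. Let $\mathcal A_{\mathcal F}$ be the set of all $s\in\overline{\mathcal F}$ such that $\mathcal F_s$ is $\omega$-uniform on $S/s$. An $\mathcal F$-tree is a nonempty set $T\subseteq\overline{\mathcal A_{\mathcal F}}$ such that (i) if $t\in T$ and $s\sqsubseteq t$, then $s\in T$; (ii) every terminal node of $T$ (i.e. every $\sqsubseteq$-maximal element of $T$) belongs to $\mathcal A_{\mathcal F}$; (iii) $\{n\in\mathbb N: t<n,\ t\cup\{n\}\in T\}$ is infinite for every non-terminal $t\in T$. For an $\mathcal F$-tree $T$ put $$E(T)=\bigcup\{\,\{n\}\cup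 t_{n+1}^{\mathcal F_s}:\ s<n,\ s\cup\{n\}\in T\,\},$$ where $t_{n+1}^{\mathcal F_s}$ is the unique element of $\mathcal F_s$ that is an initial segment of $\{n+1,n+2,\dots\}$. Then for every $\mathcal F$-tree $T$, the subspace $\mathcal F\upharpoonright E(T)$ of $\mathcal F$ contains a topological copy of $\mathcal F$: some subset of $\mathcal F\upharpoonright E(T)$, with the subspace topology inherited from $\mathcal F$, is homeomorphic to $\mathcal F$. -/

import Mathlib

namespace UnifFam

/-- `s <_lex t` iff `min (s ∆ t)` exists and belongs to `s`. -/
def LexLT (s t : Finset ℕ) : Prop :=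
  ∃ h : (symmDiff s t).Nonempty, (symmDiff s t).min' h ∈ s

/-- The order topology of `(F, <_lex)`: it is generated by the open rays of `F`. -/
@[reducible] def lexTopology (F : Set (Finset ℕ)) : TopologicalSpace F :=
  TopologicalSpace.generateFrom
    {U : Set F | ∃ s : F, U = {t : F | LexLT s t} ∨ U = {t : F | LexLT t s}}

/-- `s` is an initial segment of the set `A` of natural numbers; the empty set is an initial
segment of every set. -/
def IsInit (s : Finset ℕ) (A : Set ℕ) : Prop :=
  ∃ n : ℕ, (s : Set ℕ) = {m ∈ A | m < n}

/-- `max u < min s`, with `max ∅ = -1` and `min ∅ = ∞`. -/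
def Before (u s : Finset ℕ) : Prop := ∀ a ∈ u, ∀ b ∈ s, a < b

/-- `F_u = {s : u ∪ s ∈ F, max u < min s}`. -/
def sec (F : Set (Finset ℕ)) (u : Finset ℕ) : Set (Finset ℕ) :=
  {s | u ∪ s ∈ F ∧ Before u s}

/-- `M / u`, the elements of `M` that are greater than all elements of `u`. -/
def tail (M : Set ℕ) (u : Finset ℕ) : Set ℕ := {m ∈ M | ∀ a ∈ u, a < m}

/-- `F ↾ M`, the members of `F` that are subsets of `M`. -/
def restrict (F : Set (Finset ℕ)) (M : Set ℕ) : Set (Finset ℕ) :=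
  {s ∈ F | (s : Set ℕ) ⊆ M}

/-- `IsUniform α M F`: the family `F` of finite subsets of the infinite set `M` is `α`-uniform
on `M`. -/
inductive IsUniform : Ordinal.{0} → Set ℕ → Set (Finset ℕ) → Prop
  | zero {M : Set ℕ} (hM : M.Infinite) : IsUniform 0 M {∅}
  | succ {α : Ordinal.{0}} {M : Set ℕ} {F : Set (Finset ℕ)} (hM : M.Infinite)
      (hF : ∀ s ∈ F, (s : Set ℕ) ⊆ M) (h0 : ∅ ∉ F)
      (h : ∀ n ∈ M, IsUniform α (tail M {n}) (sec F {n})) : IsUniform (Order.succ α) M F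
  | limit {α : Ordinal.{0}} {M : Set ℕ} {F : Set (Finset ℕ)} (hM : M.Infinite)
      (hF : ∀ s ∈ F, (s : Set ℕ) ⊆ M) (h0 : ∅ ∉ F) (hα : Order.IsSuccLimit α)
      (a : ℕ → Ordinal.{0}) (ha : StrictMonoOn a M) (hlim : IsLUB (a '' M) α)
      (h : ∀ k ∈ M, IsUniform (a k) (tail M {k}) (sec F {k})) : IsUniform α M F

/-- `α` is not a sum of two smaller ordinals. -/
def IsIndecomposable (α : Ordinal.{0}) : Prop :=
  ¬ ∃ β γ : Ordinal.{0}, β < α ∧ γ < α ∧ α = β + γ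

/-- The closure of a family under initial segments. -/
def initClosure (F : Set (Finset ℕ)) : Set (Finset ℕ) :=
  {s | ∃ t ∈ F, IsInit s (t : Set ℕ)}

/-- `A_F`, for a family `F` that is uniform on `S`: the initial segments `s` of members of `F`
such that `F_s` is `ω`-uniform on `S / s`. -/
def omegaNodes (S : Set ℕ) (F : Set (Finset ℕ)) : Set (Finset ℕ) :=
  {s ∈ initClosure F | IsUniform Ordinal.omega0 (tail S s) (sec F s)}

/-- The terminal nodes of `T`. -/
def terminal (T : Set (Finset ℕ)) : Set (Finset ℕ) :=
  {t ∈ T | ∀ t' ∈ T, IsInit t (t' : Set ℕ) → t' = t}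

/-- `T` is an `F`-tree, where `F` is a uniform family on `S`. -/
structure IsTree (S : Set ℕ) (F T : Set (Finset ℕ)) : Prop where
  nonempty : T.Nonempty
  subset : T ⊆ initClosure (omegaNodes S F)
  init_mem : ∀ t ∈ T, ∀ s : Finset ℕ, IsInit s (t : Set ℕ) → s ∈ T
  terminal_subset : terminal T ⊆ omegaNodes S F
  infinite_succ : ∀ t ∈ T \ terminal T, {n : ℕ | Before t {n} ∧ t ∪ {n} ∈ T}.Infinite

/-- `t` is `t_n^F`, the member of `F` that is an initial segment of `{n, n+1, n+2, …}`
(there is at most one when the members of `F` are pairwise `⊑`-incomparable). -/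
def IsFirst (F : Set (Finset ℕ)) (n : ℕ) (t : Finset ℕ) : Prop :=
  t ∈ F ∧ IsInit t (Set.Ici n)

/-- `E(T)`, the union of the sets `{n} ∪ t_{n+1}^{F_s}` over all `s`, `n` with `s < n` and
`s ∪ {n} ∈ T`. -/
def treeSet (F T : Set (Finset ℕ)) : Set ℕ :=
  {m | ∃ (s : Finset ℕ) (n : ℕ), Before s {n} ∧ s ∪ {n} ∈ T ∧
    (m = n ∨ ∃ t, IsFirst (sec F s) (n + 1) t ∧ m ∈ t)}

/-- The subset `X` of the space `F`, with the subspace topology, contains a topological copy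
of `F`: some `Y ⊆ X` is homeomorphic to `F`. -/
def ContainsCopy (F X : Set (Finset ℕ)) : Prop :=
  letI : TopologicalSpace F := lexTopology F
  ∃ Y : Set F, (∀ t ∈ Y, (t : Finset ℕ) ∈ X) ∧ Nonempty (F ≃ₜ Y)

end UnifFam

/-! Lexicographically, an `α`-uniform family is a well-order of type at most `ω ^ α`
(`IsUniform.type_le`). A strictly increasing map from it onto an initial segment of a set `C` is a
topological embedding once `C` is closed under the relevant suprema
(`exists_isEmbedding_of_supClosed`). So it suffices to find, among the members of `F` inside `E(T)`,
a sup-closed set of type at least `ω ^ α`.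

Such a set is built by induction on the rank `β` of `F_s`, for nodes `s` of `T`
(`large_of_mem_tree`). At a node with infinitely many successors `n`, the cone of each `s ∪ {n}`
contributes a cofinal sup-closed set of type at least `ω ^ a n`. Its supremum is `s ∪
t_{n+1}^{F_s}`, which `E(T)` contains by design. Adjoining these suprema gives blocks with largest
elements; the union of a sparse sequence of blocks is sup-closed and has type at least `ω ^ β`
(`large_of_children`).

At a node of rank `ω` the tree may stop, and these suprema need not lie in `E(T)`. There
`infinite_intervals` helps: since `α ≥ ω + ω`, `E(T)` contains arbitrarily long intervals. This
settles finite ranks (`large_nat`); at rank `ω` the pieces of finite rank are truncated so as to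
have largest elements (`large_omega`). -/

namespace UnifFam

/-! ### Subsets of a well-ordered set -/

section SupClosed

variable {X : Type} [LinearOrder X]

/-- Every element of `C` is the least one, or has an immediate predecessor in `C`, or is the
supremum of the elements of `C` below it. -/
def SupClosed (C : Set X) : Prop :=
  ∀ c ∈ C, (∀ d ∈ C, c ≤ d) ∨ (∃ p ∈ C, p < c ∧ ∀ d ∈ C, d < c → d ≤ p) ∨
    ∀ x < c, ∃ d ∈ C, x ≤ d ∧ d < c

theorem SupClosed.inter_Iic {C : Set X} (h : SupClosed C) (a : X) :
    SupClosed (C ∩ Set.Iic a) := by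
  rintro c ⟨hc, hca⟩
  rcases h c hc with h | ⟨p, hp, hpc, h⟩ | h
  · exact Or.inl fun d hd => h d hd.1
  · exact Or.inr (Or.inl ⟨p, ⟨hp, hpc.le.trans hca⟩, hpc, fun d hd => h d hd.1⟩)
  · refine Or.inr (Or.inr fun x hx => ?_)
    obtain ⟨d, hd, hxd, hdc⟩ := h x hx
    exact ⟨d, ⟨hd, hdc.le.trans hca⟩, hxd, hdc⟩

theorem SupClosed.singleton (a : X) : SupClosed ({a} : Set X) := by
  rintro c rfl
  exact Or.inl fun d hd => (Set.mem_singleton_iff.1 hd).ge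

theorem SupClosed.insert_sup {C : Set X} (h : SupClosed C) {a : X} (hlt : ∀ c ∈ C, c < a)
    (hsup : ∀ x < a, ∃ c ∈ C, x ≤ c) : SupClosed (insert a C) := by
  rintro c (rfl | hc)
  · refine Or.inr (Or.inr fun x hx => ?_)
    obtain ⟨d, hd, hxd⟩ := hsup x hx
    exact ⟨d, Or.inr hd, hxd, hlt d hd⟩
  · rcases h c hc with h | ⟨p, hp, hpc, h⟩ | h
    · refine Or.inl ?_
      rintro d (rfl | hd)
      · exact (hlt c hc).le
      · exact h d hd
    · refine Or.inr (Or.inl ⟨p, Or.inr hp, hpc, ?_⟩)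
      rintro d (rfl | hd) hdc
      · exact absurd hdc (hlt c hc).asymm
      · exact h d hd hdc
    · refine Or.inr (Or.inr fun x hx => ?_)
      obtain ⟨d, hd, hxd, hdc⟩ := h x hx
      exact ⟨d, Or.inr hd, hxd, hdc⟩

/-- The union of an increasing sequence of blocks with largest elements is sup-closed. -/
theorem SupClosed.iUnion_blocks {D : ℕ → Set X} (hD : ∀ i, SupClosed (D i))
    (hmax : ∀ i, ∃ m, IsGreatest (D i) m)
    (hlt : ∀ i j, i < j → ∀ x ∈ D i, ∀ y ∈ D j, x < y) : SupClosed (⋃ i, D i) := by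
  intro c hc
  obtain ⟨i, hi⟩ := Set.mem_iUnion.1 hc
  rcases hD i c hi with h | ⟨p, hp, hpc, h⟩ | h
  · rcases i with _ | i
    · refine Or.inl fun d hd => ?_
      obtain ⟨j, hj⟩ := Set.mem_iUnion.1 hd
      rcases j.eq_zero_or_pos with rfl | hj0
      · exact h d hj
      · exact (hlt 0 j hj0 c hi d hj).le
    · obtain ⟨m, hm, hmm⟩ := hmax i
      refine Or.inr (Or.inl ⟨m, Set.mem_iUnion.2 ⟨i, hm⟩, hlt _ _ i.lt_succ_self _ hm _ hi, ?_⟩)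
      intro d hd hdc
      obtain ⟨j, hj⟩ := Set.mem_iUnion.1 hd
      rcases lt_trichotomy j i with hji | rfl | hji
      · exact (hlt j i hji d hj m hm).le
      · exact hmm hj
      · rcases (Nat.succ_le_of_lt hji).eq_or_lt with rfl | hji
        · exact absurd hdc (h d hj).not_gt
        · exact absurd hdc (hlt _ _ hji c hi d hj).asymm
  · refine Or.inr (Or.inl ⟨p, Set.mem_iUnion.2 ⟨i, hp⟩, hpc, fun d hd hdc => ?_⟩)
    obtain ⟨j, hj⟩ := Set.mem_iUnion.1 hd
    rcases lt_trichotomy j i with hji | rfl | hji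
    · exact (hlt j i hji d hj p hp).le
    · exact h d hj hdc
    · exact absurd hdc (hlt _ _ hji c hi d hj).asymm
  · refine Or.inr (Or.inr fun x hx => ?_)
    obtain ⟨d, hd, hxd, hdc⟩ := h x hx
    exact ⟨d, Set.mem_iUnion.2 ⟨i, hd⟩, hxd, hdc⟩

end SupClosed

/-! ### Order types, and embeddings into sup-closed sets -/

section WellOrder

variable {X : Type} [LinearOrder X] [WellFoundedLT X]

/-- The order type of a subset of a well-ordered set. -/
noncomputable def otp (C : Set X) : Ordinal.{0} :=
  Ordinal.type (fun a b : C => a < b)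

theorem otp_mono {C D : Set X} (h : C ⊆ D) : otp C ≤ otp D :=
  Ordinal.type_le_iff'.2 ⟨⟨⟨Set.inclusion h, Set.inclusion_injective h⟩, Iff.rfl⟩⟩

theorem otp_add_le {A B C : Set X} (hA : A ⊆ C) (hB : B ⊆ C) (h : ∀ a ∈ A, ∀ b ∈ B, a < b) :
    otp A + otp B ≤ otp C := by
  unfold otp
  rw [← Ordinal.type_sum_lex]
  refine Ordinal.type_le_iff'.2 ⟨RelEmbedding.ofMonotone
    (Sum.elim (Set.inclusion hA) (Set.inclusion hB)) ?_⟩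
  rintro (a | a) (b | b) hab
  · exact (Sum.lex_inl_inl (r := fun a b : A => a < b) (s := fun a b : B => a < b)).1 hab
  · exact h _ a.2 _ b.2
  · exact (Sum.lex_inr_inl hab).elim
  · exact (Sum.lex_inr_inr (r := fun a b : A => a < b) (s := fun a b : B => a < b)).1 hab

theorem one_le_otp {C : Set X} (h : C.Nonempty) : 1 ≤ otp C := by
  rw [Order.one_le_iff_ne_zero]
  unfold otp
  rw [Ordinal.type_ne_zero_iff_nonempty]
  exact h.to_subtype

/-- A copy of `δ` as a proper initial segment of `C` has a strict upper bound `c` in `C`. Cutting at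
`c` produces a block with a largest element at little cost in order type. -/
theorem exists_le_otp_inter_Iic {C : Set X} {δ : Ordinal.{0}} (h : δ < otp C) :
    ∃ c ∈ C, δ ≤ otp (C ∩ Set.Iic c) := by
  rw [← Ordinal.type_toType δ] at h
  unfold otp at h
  obtain ⟨f⟩ := Ordinal.type_lt_iff.1 h
  refine ⟨f.top, f.top.2, ?_⟩
  conv_lhs => rw [← Ordinal.type_toType δ]
  refine Ordinal.type_le_iff'.2 ⟨RelEmbedding.ofMonotone
    (fun x => ⟨f x, (f x).2, le_of_lt (f.lt_top x)⟩) ?_⟩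
  intro a b hab
  exact f.map_rel_iff.2 hab

/-- The ordinals `ω ^ δ * m` with `δ < β` and `m` finite are cofinal in `ω ^ β`, and `m` consecutive
late blocks already realise `ω ^ δ * m`. -/
theorem opow_le_otp_iUnion_blocks {D : ℕ → Set X} {β : Ordinal.{0}} (hβ : β ≠ 0)
    (hotp : ∀ δ < β, ∃ i₀, ∀ i, i₀ ≤ i → Ordinal.omega0 ^ δ ≤ otp (D i))
    (hlt : ∀ i j, i < j → ∀ x ∈ D i, ∀ y ∈ D j, x < y) :
    Ordinal.omega0 ^ β ≤ otp (⋃ i, D i) := by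
  refine le_of_forall_lt fun ξ hξ => ?_
  obtain ⟨δ, hδ, m, hm⟩ := (Ordinal.lt_omega0_opow hβ).1 hξ
  obtain ⟨i₀, hi₀⟩ := hotp δ hδ
  have key : ∀ m : ℕ, Ordinal.omega0 ^ δ * (m : Ordinal) ≤ otp (⋃ i < i₀ + m, D i) := by
    intro m
    induction m with
    | zero => simp
    | succ m ih =>
      rw [Nat.cast_succ, mul_add_one]
      refine (add_le_add ih (hi₀ (i₀ + m) (Nat.le_add_right _ _))).trans
        (otp_add_le ?_ ?_ ?_)
      · exact Set.biUnion_subset_biUnion_left fun i hi => Nat.lt_succ_of_lt hi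
      · exact Set.subset_biUnion_of_mem (u := D) (Nat.lt_succ_self (i₀ + m))
      · intro a ha b hb
        simp only [Set.mem_iUnion] at ha
        obtain ⟨i, hi, ha⟩ := ha
        exact hlt _ _ hi a ha b hb
  exact hm.trans_le ((key m).trans (otp_mono (Set.iUnion₂_subset fun i _ =>
    Set.subset_iUnion D i)))

/-- Comparing order types gives a map of `X` onto an initial segment of `C`. Only continuity from
the left is at stake, and it holds because limit points of `C` are true suprema in `X`. -/
theorem exists_isEmbedding_of_supClosed [TopologicalSpace X] [OrderTopology X] {C : Set X}
    (hC : SupClosed C) (h : Ordinal.type (fun a b : X => a < b) ≤ otp C) :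
    ∃ f : X → X, Topology.IsEmbedding f ∧ ∀ x, f x ∈ C := by
  obtain ⟨e⟩ := Ordinal.type_le_iff.1 h
  let f : X → X := fun x => (e x : X)
  have hf : StrictMono f := fun a b hab => e.map_rel_iff.2 hab
  have hinit : ∀ x, ∀ c ∈ C, c < f x → ∃ y, f y = c := fun x c hc hcx => by
    obtain ⟨y, hy⟩ := e.mem_range_of_rel (a := x) (b := ⟨c, hc⟩) hcx
    exact ⟨y, congrArg Subtype.val hy⟩
  -- In a well-order a proper lower set is the open ray below its least missing element.
  have hlower : ∀ s : Set X, IsLowerSet s → IsOpen s := fun s hs => by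
    by_cases hu : s = Set.univ
    · rw [hu]; exact isOpen_univ
    · have hne : (sᶜ).Nonempty := Set.nonempty_compl.2 hu
      obtain ⟨m, hm, hmin⟩ := WellFounded.has_min (wellFounded_lt (α := X)) _ hne
      have : s = Set.Iio m := by
        ext x
        refine ⟨fun hx => ?_, fun hx => ?_⟩
        · by_contra hmx
          exact hm (hs (not_lt.1 hmx) hx)
        · by_contra hxs
          exact hmin x hxs hx
      rw [this]; exact isOpen_Iio
  have hcont : Continuous f := by
    rw [OrderTopology.topology_eq_generate_intervals (α := X), continuous_generateFrom_iff]
    rw [← OrderTopology.topology_eq_generate_intervals (α := X)]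
    rintro _ ⟨a, rfl | rfl⟩
    · rw [isOpen_iff_mem_nhds]
      intro x hx
      have hx : a < f x := hx
      -- The three clauses of `SupClosed` give as neighbourhood of `x` the whole space, the ray
      -- above the preimage of the predecessor, or the ray above the preimage of some `d ≥ a`.
      rcases hC (f x) (e x).2 with h | ⟨p, hp, hpx, h⟩ | h
      · have hbot : ∀ y, x ≤ y := fun y => hf.le_iff_le.1 (h _ (e y).2)
        exact Filter.mem_of_superset Filter.univ_mem
          fun y _ => hx.trans_le (hf.monotone (hbot y))
      · obtain ⟨y, rfl⟩ := hinit x p hp hpx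
        refine Filter.mem_of_superset (Ioi_mem_nhds (hf.lt_iff_lt.1 hpx)) fun z hz => ?_
        refine hx.trans_le (hf.monotone ?_)
        by_contra! hzx
        exact (hf.lt_iff_lt.2 (Set.mem_Ioi.1 hz)).not_ge (h _ (e z).2 (hf hzx))
      · obtain ⟨d, hd, had, hdx⟩ := h a hx
        obtain ⟨y, rfl⟩ := hinit x d hd hdx
        exact Filter.mem_of_superset (Ioi_mem_nhds (hf.lt_iff_lt.1 hdx))
          fun z hz => had.trans_lt (hf (Set.mem_Ioi.1 hz))
    · exact hlower _ fun x y hyx hx => (hf.monotone hyx).trans_lt hx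
  refine ⟨f, ⟨⟨le_antisymm hcont.le_induced ?_⟩, hf.injective⟩, fun x => (e x).2⟩
  conv_rhs => rw [OrderTopology.topology_eq_generate_intervals (α := X)]
  refine le_generateFrom ?_
  rintro _ ⟨a, rfl | rfl⟩
  · exact ⟨Set.Ioi (f a), isOpen_Ioi, by ext x; exact hf.lt_iff_lt⟩
  · exact ⟨Set.Iio (f a), isOpen_Iio, by ext x; exact hf.lt_iff_lt⟩

end WellOrder

/-! ### The lexicographic order on a family -/

theorem lexLT_iff {s t : Finset ℕ} :
    LexLT s t ↔ ∃ n ∈ s, n ∉ t ∧ ∀ m < n, (m ∈ s ↔ m ∈ t) := by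
  constructor
  · rintro ⟨h, hs⟩
    refine ⟨_, hs, fun ht => ?_, fun m hm => ?_⟩
    · have := Finset.min'_mem _ h
      rw [Finset.mem_symmDiff] at this
      tauto
    · by_contra hne
      have : m ∈ symmDiff s t := by rw [Finset.mem_symmDiff]; tauto
      exact absurd hm (Finset.min'_le _ _ this).not_gt
  · rintro ⟨n, hs, ht, h⟩
    have hn : n ∈ symmDiff s t := Finset.mem_symmDiff.2 (Or.inl ⟨hs, ht⟩)
    refine ⟨⟨n, hn⟩, ?_⟩
    have : (symmDiff s t).min' ⟨n, hn⟩ = n := by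
      refine le_antisymm (Finset.min'_le _ _ hn) (Finset.le_min' _ _ _ fun m hm => ?_)
      by_contra! hlt
      have := h m hlt
      rw [Finset.mem_symmDiff] at hm
      tauto
    rw [this]
    exact hs

theorem LexLT.irrefl (s : Finset ℕ) : ¬ LexLT s s := by
  rw [lexLT_iff]
  rintro ⟨n, h, h', -⟩
  exact h' h

theorem LexLT.trans {s t u : Finset ℕ} (h : LexLT s t) (h' : LexLT t u) : LexLT s u := by
  rw [lexLT_iff] at *
  obtain ⟨n, hs, ht, hn⟩ := h
  obtain ⟨m, ht', hu, hm⟩ := h'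
  rcases lt_trichotomy n m with hnm | rfl | hnm
  · exact ⟨n, hs, fun h => ht ((hm n hnm).2 h), fun p hp =>
      (hn p hp).trans (hm p (hp.trans hnm))⟩
  · exact absurd ht' ht
  · exact ⟨m, (hn m hnm).2 ht', hu, fun p hp => (hn p (hp.trans hnm)).trans (hm p hp)⟩

theorem lexLT_trichotomous {s t : Finset ℕ} (h : s ≠ t) : LexLT s t ∨ LexLT t s := by
  have hne : (symmDiff s t).Nonempty := by
    rw [Finset.nonempty_iff_ne_empty]
    exact fun h' => h (symmDiff_eq_bot.1 h')
  have := Finset.min'_mem _ hne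
  rcases Finset.mem_symmDiff.1 this with h | h
  · exact Or.inl ⟨hne, h.1⟩
  · refine Or.inr ⟨by rwa [symmDiff_comm], ?_⟩
    simp only [symmDiff_comm t s]
    exact h.1

/-- The members of a family, ordered by `<_lex`. -/
@[ext] structure LexFam (F : Set (Finset ℕ)) where
  fin : Finset ℕ
  mem : fin ∈ F

variable {F : Set (Finset ℕ)}

-- A separate structure carries this order because the subtype of `F` inherits the inclusion order
-- of finite sets.
open Classical in
noncomputable instance : LinearOrder (LexFam F) where
  lt x y := LexLT x.fin y.fin
  le x y := x = y ∨ LexLT x.fin y.fin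
  le_refl _ := Or.inl rfl
  le_trans x y z := by
    rintro (rfl | h) (rfl | h')
    · exact Or.inl rfl
    · exact Or.inr h'
    · exact Or.inr h
    · exact Or.inr (h.trans h')
  le_antisymm x y := by
    rintro (rfl | h) (h' | h')
    · rfl
    · rfl
    · exact h'.symm
    · exact (LexLT.irrefl _ (h.trans h')).elim
  le_total x y := by
    by_cases h : x = y
    · exact Or.inl (Or.inl h)
    · rcases lexLT_trichotomous fun h' => h (LexFam.ext h') with h | h
      · exact Or.inl (Or.inr h)
      · exact Or.inr (Or.inr h)
  lt_iff_le_not_ge x y := by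
    constructor
    · refine fun h => ⟨Or.inr h, ?_⟩
      rintro (rfl | h')
      · exact LexLT.irrefl _ h
      · exact LexLT.irrefl _ (h.trans h')
    · rintro ⟨rfl | h, h'⟩
      · exact (h' (Or.inl rfl)).elim
      · exact h
  toDecidableLE := Classical.decRel _

theorem LexFam.lt_iff {x y : LexFam F} : x < y ↔ LexLT x.fin y.fin := Iff.rfl

noncomputable instance : TopologicalSpace (LexFam F) := Preorder.topology _

instance : OrderTopology (LexFam F) := ⟨rfl⟩

theorem containsCopy_of_isEmbedding {A : Set (Finset ℕ)} (f : LexFam F → LexFam F)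
    (hf : Topology.IsEmbedding f) (hA : ∀ x, (f x).fin ∈ A) : ContainsCopy F A := by
  let _ : TopologicalSpace F := lexTopology F
  let e : F ≃ LexFam F :=
    ⟨fun s => ⟨s.1, s.2⟩, fun x => ⟨x.fin, x.mem⟩, fun _ => rfl, fun _ => rfl⟩
  have h1 : Continuous e := by
    refine continuous_generateFrom_iff.2 ?_
    rintro _ ⟨a, rfl | rfl⟩
    · exact TopologicalSpace.isOpen_generateFrom_of_mem ⟨e.symm a, Or.inl rfl⟩
    · exact TopologicalSpace.isOpen_generateFrom_of_mem ⟨e.symm a, Or.inr rfl⟩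
  have h2 : Continuous e.symm := by
    refine continuous_generateFrom_iff.2 ?_
    rintro _ ⟨a, rfl | rfl⟩
    · exact TopologicalSpace.isOpen_generateFrom_of_mem ⟨e a, Or.inl rfl⟩
    · exact TopologicalSpace.isOpen_generateFrom_of_mem ⟨e a, Or.inr rfl⟩
  let h : F ≃ₜ LexFam F := ⟨e, h1, h2⟩
  have hg : Topology.IsEmbedding (h.symm ∘ f ∘ h) :=
    h.symm.isEmbedding.comp (hf.comp h.isEmbedding)
  refine ⟨Set.range (h.symm ∘ f ∘ h), ?_, ⟨hg.toHomeomorph⟩⟩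
  rintro _ ⟨x, rfl⟩
  exact hA _

/-! ### Uniform families -/

theorem sec_sec {u v : Finset ℕ} (h : Before u v) : sec (sec F u) v = sec F (u ∪ v) := by
  ext x
  simp only [sec, Before, Set.mem_ofPred_eq, Finset.mem_union, Finset.union_assoc] at *
  constructor
  · rintro ⟨⟨h1, h2⟩, h3⟩
    exact ⟨h1, fun a ha b hb => ha.elim (fun ha => h2 a ha b (Or.inr hb)) fun ha => h3 a ha b hb⟩
  · rintro ⟨h1, h2⟩
    exact ⟨⟨h1, fun a ha b hb => hb.elim (fun hb => h a ha b hb) fun hb => h2 a (Or.inl ha) b hb⟩,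
      fun a ha b hb => h2 a (Or.inr ha) b hb⟩

theorem tail_tail {M : Set ℕ} {u v : Finset ℕ} : tail (tail M u) v = tail M (u ∪ v) := by
  ext x
  simp only [tail, Set.mem_ofPred_eq, Finset.mem_union, and_assoc, or_imp, forall_and]

/-- The data provided by the recursive clauses of the definition of uniform families, with
`a n` the rank of `G_{n}`. -/
structure IsStep (β : Ordinal.{0}) (M : Set ℕ) (G : Set (Finset ℕ)) (a : ℕ → Ordinal.{0}) :
    Prop where
  subset : ∀ s ∈ G, (s : Set ℕ) ⊆ M
  empty_notMem : ∅ ∉ G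
  mono : MonotoneOn a M
  lt : ∀ n ∈ M, a n < β
  cof : ∀ δ < β, ∃ n₀, ∀ n ∈ M, n₀ ≤ n → δ ≤ a n
  succ : ∀ γ, β = Order.succ γ → ∀ n ∈ M, a n = γ
  sec : ∀ n ∈ M, IsUniform (a n) (tail M {n}) (sec G {n})

theorem IsUniform.infinite {β M G} (h : IsUniform β M G) : M.Infinite := by
  cases h <;> assumption

theorem IsUniform.eq_zero_or_isStep {β M G} (h : IsUniform β M G) :
    (β = 0 ∧ G = {∅}) ∨ ∃ a, IsStep β M G a := by
  cases h with
  | zero hM => exact Or.inl ⟨rfl, rfl⟩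
  | @succ γ _ _ hM hF h0 h =>
    refine Or.inr ⟨fun _ => γ, hF, h0, fun _ _ _ _ _ => le_rfl, fun _ _ => Order.lt_succ γ,
      fun δ hδ => ⟨0, fun _ _ _ => Order.lt_succ_iff.1 hδ⟩, fun δ hδ _ _ => ?_, h⟩
    exact Order.succ_injective hδ
  | limit hM hF h0 hα a ha hlim h =>
    refine Or.inr ⟨a, hF, h0, ha.monotoneOn, fun n hn => ?_, fun δ hδ => ?_, fun γ hγ => ?_, h⟩
    · obtain ⟨m, hm, hnm⟩ := hM.exists_gt n
      exact (ha hn hm hnm).trans_le (hlim.1 ⟨m, hm, rfl⟩)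
    · obtain ⟨_, ⟨n₀, hn₀, rfl⟩, hlt⟩ := (lt_isLUB_iff hlim).1 hδ
      exact ⟨n₀, fun n hn hle => hlt.le.trans (ha.monotoneOn hn₀ hn hle)⟩
    · subst hγ
      exact (Order.not_isSuccLimit_succ _ hα).elim

theorem IsStep.ne_zero {β M G a} (h : IsStep β M G a) (hM : M.Infinite) : β ≠ 0 := by
  obtain ⟨n, hn⟩ := hM.nonempty
  exact (zero_le.trans_lt (h.lt n hn)).ne'

@[elab_as_elim]
theorem IsUniform.induction {P : ∀ β M G, IsUniform β M G → Prop}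
    (zero : ∀ (M : Set ℕ) (h : IsUniform 0 M {∅}), P 0 M {∅} h)
    (step : ∀ β M G (h : IsUniform β M G) (a : ℕ → Ordinal.{0}) (ha : IsStep β M G a),
      (∀ n (hn : n ∈ M), P (a n) (tail M {n}) (UnifFam.sec G {n}) (ha.sec n hn)) → P β M G h)
    {β M G} (h : IsUniform β M G) : P β M G h := by
  induction β using WellFoundedLT.induction generalizing M G with
  | ind β ih =>
    rcases h.eq_zero_or_isStep with ⟨rfl, rfl⟩ | ⟨a, ha⟩
    · exact zero M h
    · exact step β M G h a ha fun n hn => ih _ (ha.lt n hn) (ha.sec n hn)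

theorem IsUniform.nonempty {β M G} (h : IsUniform β M G) : G.Nonempty := by
  induction h using IsUniform.induction with
  | zero M h => exact ⟨∅, rfl⟩
  | step β M G h a ha ih =>
    have hM := h.infinite
    obtain ⟨n, hn⟩ := hM.nonempty
    obtain ⟨x, hx⟩ := ih n hn
    exact ⟨_, hx.1⟩

/-- By induction the ranks of the sections agree, and their eventual bounds determine the rank of
the family. This identifies the rank of a node known to be an `ω`-node. -/
theorem IsUniform.unique {β γ M G} (h : IsUniform β M G) (h' : IsUniform γ M G) : β = γ := by
  induction h using IsUniform.induction generalizing γ with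
  | zero M h =>
    rcases h'.eq_zero_or_isStep with ⟨rfl, -⟩ | ⟨a, ha⟩
    · rfl
    · exact (ha.empty_notMem rfl).elim
  | step β M G h a ha ih =>
    have hM := h.infinite
    rcases h'.eq_zero_or_isStep with ⟨rfl, rfl⟩ | ⟨b, hb⟩
    · exact (ha.empty_notMem rfl).elim
    · have hab : ∀ n ∈ M, a n = b n := fun n hn => ih n hn (hb.sec n hn)
      refine le_antisymm ?_ ?_ <;> by_contra! hlt
      · obtain ⟨n₀, hn₀⟩ := ha.cof _ hlt
        obtain ⟨n, hn, hle⟩ := hM.exists_gt n₀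
        exact ((hn₀ n hn hle.le).trans_eq (hab n hn)).not_gt (hb.lt n hn)
      · obtain ⟨n₀, hn₀⟩ := hb.cof _ hlt
        obtain ⟨n, hn, hle⟩ := hM.exists_gt n₀
        exact ((hn₀ n hn hle.le).trans_eq (hab n hn).symm).not_gt (ha.lt n hn)

theorem exists_eq_cons_of_nonempty {s : Finset ℕ} (h : s.Nonempty) :
    ∃ n t, s = {n} ∪ t ∧ Before {n} t := by
  refine ⟨s.min' h, s.erase (s.min' h), ?_, ?_⟩
  · rw [← Finset.insert_eq, Finset.insert_erase (s.min'_mem h)]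
  · intro a ha b hb
    rw [Finset.mem_singleton.1 ha]
    exact Finset.min'_lt_of_mem_erase_min' _ _ hb

/-- Every member of a family of positive rank is `{n} ∪ t` with `t ∈ G_{n}`. -/
theorem IsStep.exists_cons {β M G a} (h : IsStep β M G a) {s : Finset ℕ} (hs : s ∈ G) :
    ∃ n ∈ M, ∃ t ∈ UnifFam.sec G {n}, s = {n} ∪ t := by
  obtain ⟨n, t, rfl, ht⟩ := exists_eq_cons_of_nonempty
    (Finset.nonempty_iff_ne_empty.2 fun h' => h.empty_notMem (h' ▸ hs))
  exact ⟨n, h.subset _ hs (by simp), t, ⟨hs, ht⟩, rfl⟩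

/-- No member of a uniform family is a proper initial segment of another one. -/
theorem IsUniform.sperner {β M G} (h : IsUniform β M G) {u v : Finset ℕ} (hu : u ∈ G)
    (huv : u ∪ v ∈ G) (hb : Before u v) : v = ∅ := by
  induction h using IsUniform.induction generalizing u v with
  | zero M h =>
    rw [Set.mem_singleton_iff.1 hu] at huv
    simpa using huv
  | step β M G h a ha ih =>
    have hM := h.infinite
    obtain ⟨n, hn, t, ht, rfl⟩ := ha.exists_cons hu
    refine ih n hn ht (v := v) ⟨?_, ?_⟩ ?_
    · rwa [← Finset.union_assoc]
    · intro p hp q hq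
      rcases Finset.mem_union.1 hq with hq | hq
      · exact ht.2 p hp q hq
      · exact hb p (Finset.mem_union_left _ hp) q hq
    · exact fun p hp q hq => hb p (Finset.mem_union_right _ hp) q hq

theorem card_cons {n : ℕ} {t : Finset ℕ} (h : Before {n} t) : ({n} ∪ t).card = t.card + 1 := by
  rw [← Finset.insert_eq, Finset.card_insert_of_notMem fun hn => ?_]
  exact (h n (Finset.mem_singleton_self n) n hn).false

theorem IsUniform.card_eq {j : ℕ} {M G} (h : IsUniform j M G) {x : Finset ℕ} (hx : x ∈ G) :
    x.card = j := by
  induction j generalizing M G x with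
  | zero =>
    rcases h.eq_zero_or_isStep with ⟨-, rfl⟩ | ⟨a, ha⟩
    · rw [Set.mem_singleton_iff.1 hx]; rfl
    · exact (ha.ne_zero h.infinite Nat.cast_zero).elim
  | succ j ih =>
    rcases h.eq_zero_or_isStep with ⟨h0, -⟩ | ⟨a, ha⟩
    · exact absurd h0 (by exact_mod_cast j.succ_ne_zero)
    · obtain ⟨n, hn, t, ht, rfl⟩ := ha.exists_cons hx
      have hs := ha.sec n hn
      rw [ha.succ j (by rw [Nat.cast_succ, Order.succ_eq_add_one]) n hn] at hs
      rw [card_cons ht.2, ih hs ht]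

/-- Each of the `j` final successor steps of the rank costs one element. -/
theorem IsUniform.le_card {γ : Ordinal.{0}} {j : ℕ} {M G} (h : IsUniform (γ + j) M G)
    {x : Finset ℕ} (hx : x ∈ G) : j ≤ x.card := by
  induction j generalizing M G x with
  | zero => exact Nat.zero_le _
  | succ j ih =>
    have hsucc : γ + ((j + 1 : ℕ) : Ordinal) = Order.succ (γ + j) := by
      rw [Nat.cast_succ, Order.succ_eq_add_one, add_assoc]
    rcases h.eq_zero_or_isStep with ⟨h0, -⟩ | ⟨a, ha⟩
    · rw [hsucc] at h0
      exact (Order.succ_ne_bot _ h0).elim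
    · obtain ⟨n, hn, t, ht, rfl⟩ := ha.exists_cons hx
      have hs := ha.sec n hn
      rw [ha.succ _ hsucc n hn] at hs
      rw [card_cons ht.2]
      exact Nat.succ_le_succ (ih hs ht)

theorem IsUniform.exists_isFirst {β M G} (h : IsUniform β M G) {n : ℕ}
    (hn : ∀ m, n ≤ m → m ∈ M) : ∃ t, IsFirst G n t := by
  induction h using IsUniform.induction generalizing n with
  | zero M h => exact ⟨∅, rfl, 0, by simp⟩
  | step β M G h a ha ih =>
    have hM := h.infinite
    obtain ⟨t, ht, N, hN⟩ := @ih n (hn n le_rfl) (n + 1) fun m hm =>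
      ⟨hn m (n.le_succ.trans hm), fun p hp => by rw [Finset.mem_singleton.1 hp]; exact hm⟩
    refine ⟨{n} ∪ t, ht.1, max N (n + 1), ?_⟩
    ext m
    have := Set.ext_iff.1 hN m
    simp only [Finset.mem_coe, Set.mem_ofPred_eq, Set.mem_Ici] at this
    simp only [Finset.coe_union, Finset.coe_singleton, Set.mem_union, Set.mem_singleton_iff,
      Finset.mem_coe, Set.mem_ofPred_eq, Set.mem_Ici, this]
    omega

/-! ### The order type of a uniform family -/

theorem lexLT_of_lexLT_cons {n : ℕ} {s t : Finset ℕ} (hs : Before {n} s)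
    (ht : Before {n} t) (h : LexLT ({n} ∪ s) ({n} ∪ t)) : LexLT s t := by
  rw [lexLT_iff] at *
  simp only [Before, Finset.mem_singleton, forall_eq] at hs ht
  obtain ⟨p, hp, hpt, hlt⟩ := h
  simp only [Finset.mem_union, Finset.mem_singleton, not_or] at hp hpt hlt
  refine ⟨p, hp.resolve_left hpt.1, hpt.2, fun m hm => ?_⟩
  rcases eq_or_ne m n with rfl | hne
  · exact ⟨fun h => (hs m h).false.elim, fun h => (ht m h).false.elim⟩
  · simpa [hne] using hlt m hm

theorem le_of_lexLT_cons {n m : ℕ} {s t : Finset ℕ} (hs : Before {n} s)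
    (h : LexLT ({n} ∪ s) ({m} ∪ t)) : n ≤ m := by
  rw [lexLT_iff] at *
  simp only [Before, Finset.mem_singleton, forall_eq] at hs
  obtain ⟨p, hp, hpt, hlt⟩ := h
  simp only [Finset.mem_union, Finset.mem_singleton, not_or] at hp hpt hlt
  by_contra! hmn
  have hnp : n ≤ p := hp.elim (fun h => h.ge) fun h => (hs p h).le
  have := (hlt m (hmn.trans_le hnp)).2 (Or.inl rfl)
  rcases this with rfl | h
  · exact hmn.false
  · exact (hs m h).asymm hmn

/-- A `β`-uniform family is mapped into `ω ^ β` by a strictly monotone map. -/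
theorem IsUniform.exists_rank {β M G} (h : IsUniform β M G) :
    ∃ ρ : Finset ℕ → Ordinal.{0}, (∀ s ∈ G, ρ s < Ordinal.omega0 ^ β) ∧
      ∀ s ∈ G, ∀ t ∈ G, LexLT s t → ρ s < ρ t := by
  induction h using IsUniform.induction with
  | zero M h =>
    refine ⟨fun _ => 0, fun _ _ => by simp, ?_⟩
    rintro _ rfl _ rfl h
    exact (LexLT.irrefl _ h).elim
  | step β M G h a ha ih =>
    have hM := h.infinite
    choose! r hr hrlt using ih
    -- Recovers `n` and `t` from `{n} ∪ t`, so that the rank can be defined on the set itself.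
    have hmin : ∀ (n : ℕ) (t : Finset ℕ), Before {n} t →
        sInf (({n} ∪ t : Finset ℕ) : Set ℕ) = n ∧ ({n} ∪ t).erase n = t := fun n t h => by
      simp only [Before, Finset.mem_singleton, forall_eq] at h
      refine ⟨IsLeast.csInf_eq ⟨by simp, fun m hm => ?_⟩, ?_⟩
      · rcases Finset.mem_union.1 (Finset.mem_coe.1 hm) with hm | hm
        · exact (Finset.mem_singleton.1 hm).ge
        · exact (h m hm).le
      · rw [← Finset.insert_eq, Finset.erase_insert fun hn => (h n hn).false]
    -- The values for `n` lie in `[ω ^ a n * (n + 1), ω ^ a n * (n + 2))`. As `a` is monotone on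
    -- `M`, these intervals are disjoint and increase with `n`, even where `a` is constant.
    let ρ : ℕ → Finset ℕ → Ordinal.{0} := fun n t =>
      Ordinal.omega0 ^ a n * ((n + 1 : ℕ) : Ordinal) + r n t
    have hρ : ∀ n ∈ M, ∀ t ∈ UnifFam.sec G {n},
        ρ n t < Ordinal.omega0 ^ a n * ((n + 2 : ℕ) : Ordinal) := fun n hn t ht => by
      rw [show ((n + 2 : ℕ) : Ordinal) = ((n + 1 : ℕ) : Ordinal) + 1 from Nat.cast_succ _,
        mul_add_one]
      exact (add_lt_add_iff_left _).2 (hr n hn t ht)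
    refine ⟨fun s => ρ (sInf (s : Set ℕ)) (s.erase (sInf (s : Set ℕ))), fun s hs => ?_,
      fun s hsG t htG hlt => ?_⟩
    · obtain ⟨n, hn, t, ht, rfl⟩ := ha.exists_cons hs
      simp only [hmin n t ht.2]
      exact (Ordinal.lt_omega0_opow (ha.ne_zero hM)).2 ⟨a n, ha.lt n hn, n + 2, hρ n hn t ht⟩
    · obtain ⟨n, hn, s, hs, rfl⟩ := ha.exists_cons hsG
      obtain ⟨m, hm, t, ht, rfl⟩ := ha.exists_cons htG
      simp only [hmin n s hs.2, hmin m t ht.2]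
      rcases (le_of_lexLT_cons hs.2 hlt).eq_or_lt with rfl | hnm
      · exact (add_lt_add_iff_left _).2
          (hrlt n hn s hs t ht (lexLT_of_lexLT_cons hs.2 ht.2 hlt))
      · refine (hρ n hn s hs).trans_le (le_trans ?_ le_self_add)
        exact mul_le_mul' (Ordinal.opow_le_opow_right Ordinal.omega0_pos (ha.mono hn hm hnm.le))
          (by exact_mod_cast Nat.succ_le_succ hnm)

theorem IsUniform.wellFoundedLT {β M} (h : IsUniform β M F) : WellFoundedLT (LexFam F) := by
  obtain ⟨ρ, -, hρ⟩ := h.exists_rank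
  have : StrictMono fun x : LexFam F => ρ x.fin := fun x y hxy => hρ _ x.mem _ y.mem hxy
  exact this.wellFoundedLT

theorem IsUniform.type_le {β M} [WellFoundedLT (LexFam F)] (h : IsUniform β M F) :
    Ordinal.type (fun x y : LexFam F => x < y) ≤ Ordinal.omega0 ^ β := by
  obtain ⟨ρ, hlt, hρ⟩ := h.exists_rank
  rw [← Ordinal.type_toType (Ordinal.omega0 ^ β)]
  refine Ordinal.type_le_iff'.2 ⟨RelEmbedding.ofMonotone
    (fun x => Ordinal.ToType.mk ⟨ρ x.fin, hlt _ x.mem⟩) ?_⟩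
  intro x y hxy
  exact Ordinal.ToType.mk.lt_iff_lt.2 (hρ _ x.mem _ y.mem hxy)

open Ordinal (omega0)

/-! ### Cones -/

section Cone

/-- The members of `F` that have `s` as an initial segment. -/
def cone (F : Set (Finset ℕ)) (s : Finset ℕ) : Set (LexFam F) :=
  {x | ∃ y ∈ sec F s, x.fin = s ∪ y}

theorem before_singleton {s : Finset ℕ} {n : ℕ} : Before s {n} ↔ ∀ a ∈ s, a < n := by
  simp [Before]

theorem singleton_before {s : Finset ℕ} {n : ℕ} : Before {n} s ↔ ∀ a ∈ s, n < a := by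
  simp [Before]

theorem before_union {u v w : Finset ℕ} : Before (u ∪ v) w ↔ Before u w ∧ Before v w := by
  simp only [Before, Finset.mem_union, or_imp, forall_and]

theorem cone_lt_cone {s : Finset ℕ} {m n : ℕ} (hs : Before s {m}) (hmn : m < n) {x y : LexFam F}
    (hx : x ∈ cone F (s ∪ {m})) (hy : y ∈ cone F (s ∪ {n})) : x < y := by
  obtain ⟨u, hu, hxu⟩ := hx
  obtain ⟨v, hv, hyv⟩ := hy
  rw [LexFam.lt_iff, lexLT_iff, hxu, hyv]
  have hu2 := singleton_before.1 (before_union.1 hu.2).2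
  have hv2 := singleton_before.1 (before_union.1 hv.2).2
  rw [before_singleton] at hs
  simp only [Finset.mem_union, Finset.mem_singleton]
  refine ⟨m, Or.inl (Or.inr rfl), ?_, fun p hp => ?_⟩
  · rintro ((h | h) | h)
    · exact (hs m h).false
    · exact hmn.ne h
    · exact (hv2 m h).asymm hmn
  · constructor
    · rintro ((h | h) | h)
      · exact Or.inl (Or.inl h)
      · omega
      · have := hu2 p h; omega
    · rintro ((h | h) | h)
      · exact Or.inl (Or.inl h)
      · omega
      · have := hv2 p h; omega

theorem cone_union_singleton_subset {s : Finset ℕ} {n : ℕ} (hs : Before s {n}) :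
    cone F (s ∪ {n}) ⊆ cone F s := by
  rintro x ⟨u, hu, hxu⟩
  refine ⟨{n} ∪ u, ⟨?_, ?_⟩, ?_⟩
  · rw [← Finset.union_assoc]; exact hu.1
  · intro a ha b hb
    rcases Finset.mem_union.1 hb with hb | hb
    · exact hs a ha b hb
    · exact hu.2 a (Finset.mem_union_left _ ha) b hb
  · rw [hxu, Finset.union_assoc]

theorem exists_mem_cone_union_singleton {s : Finset ℕ} (h : ∅ ∉ sec F s) {x : LexFam F}
    (hx : x ∈ cone F s) : ∃ m, Before s {m} ∧ x ∈ cone F (s ∪ {m}) := by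
  obtain ⟨u, hu, hxu⟩ := hx
  obtain ⟨m, v, rfl, hv⟩ := exists_eq_cons_of_nonempty
    (Finset.nonempty_iff_ne_empty.2 fun h' => h (h' ▸ hu))
  refine ⟨m, fun a ha b hb => hu.2 a ha b (Finset.mem_union_left _ hb), v, ⟨?_, ?_⟩, ?_⟩
  · rw [Finset.union_assoc]; exact hu.1
  · exact before_union.2 ⟨fun a ha b hb => hu.2 a ha b (Finset.mem_union_right _ hb), hv⟩
  · rw [hxu, Finset.union_assoc]

theorem isInit_Ici_iff {t : Finset ℕ} {n : ℕ} :
    IsInit t (Set.Ici n) ↔ ∃ N, t = Finset.Ico n N := by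
  refine exists_congr fun N => ?_
  rw [← Finset.coe_inj, Finset.coe_Ico]
  rfl

/-- As `∅ ∉ F_s`, the set `t` is nonempty and so starts with `n + 1`. Thus the supremum adjoined to
the cone at `n` lies in the next cone. -/
theorem mem_cone_succ {s t : Finset ℕ} {n : ℕ} (h : ∅ ∉ sec F s) (ht : IsFirst (sec F s) (n + 1) t)
    (x : LexFam F) (hx : x.fin = s ∪ t) : x ∈ cone F (s ∪ {n + 1}) := by
  obtain ⟨N, rfl⟩ := isInit_Ici_iff.1 ht.2
  have hne : n + 1 < N := by
    by_contra! hN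
    rw [Finset.Ico_eq_empty_of_le hN] at ht
    exact h ht.1
  have heq : s ∪ {n + 1} ∪ Finset.Ico (n + 1 + 1) N = s ∪ Finset.Ico (n + 1) N := by
    rw [Finset.union_assoc, ← Finset.insert_eq, Finset.insert_Ico_add_one_left_eq_Ico hne]
  refine ⟨Finset.Ico (n + 1 + 1) N, ⟨heq ▸ ht.1.1, before_union.2 ⟨?_, ?_⟩⟩, hx.trans heq.symm⟩
  · intro a ha b hb
    exact ht.1.2 a ha b (Finset.Ico_subset_Ico_left (Nat.le_succ _) hb)
  · rw [singleton_before]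
    intro a ha
    exact (Finset.mem_Ico.1 ha).1

/-- The point `s ∪ t_{n+1}^{F_s}` is the supremum of the cone of `s ∪ {n}`. -/
theorem exists_le_of_lt_first {α : Ordinal.{0}} {M : Set ℕ} (hF : IsUniform α M F)
    {s t : Finset ℕ} {n : ℕ} (hs : Before s {n}) (hne : (cone F (s ∪ {n})).Nonempty)
    (ht : IsFirst (sec F s) (n + 1) t) (l : LexFam F) (hl : l.fin = s ∪ t) {x : LexFam F}
    (hx : x < l) : ∃ c ∈ cone F (s ∪ {n}), x ≤ c := by
  obtain ⟨N, rfl⟩ := isInit_Ici_iff.1 ht.2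
  rw [before_singleton] at hs
  rw [LexFam.lt_iff, lexLT_iff, hl] at hx
  obtain ⟨q, hq, hql, hlt⟩ := hx
  simp only [Finset.mem_union, Finset.mem_Ico, not_or] at hql hlt
  -- Here `q ∈ x` is where `x` and `l` first differ. If `q < n`, then `x` is below the whole cone;
  -- if `q = n`, then `x` is in the cone; if `q > n`, then `l` would be a proper initial segment of
  -- `x`, against `IsUniform.sperner`.
  rcases lt_trichotomy q n with hqn | rfl | hqn
  · obtain ⟨c, z, hz, hcz⟩ := hne
    have hz2 := singleton_before.1 (before_union.1 hz.2).2
    refine ⟨c, ⟨z, hz, hcz⟩, le_of_lt ?_⟩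
    rw [LexFam.lt_iff, lexLT_iff, hcz]
    simp only [Finset.mem_union, Finset.mem_singleton]
    refine ⟨q, hq, ?_, fun m hm => ?_⟩
    · rintro ((h | h) | h)
      · exact hql.1 h
      · omega
      · have := hz2 q h; omega
    · rw [hlt m hm]
      constructor
      · rintro (h | h)
        · exact Or.inl (Or.inl h)
        · omega
      · rintro ((h | h) | h)
        · exact Or.inl h
        · omega
        · have := hz2 m h; omega
  · refine ⟨x, ⟨x.fin.filter (q < ·), ?_⟩, le_rfl⟩
    have heq : x.fin = s ∪ {q} ∪ x.fin.filter (q < ·) := by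
      ext m
      simp only [Finset.mem_union, Finset.mem_singleton, Finset.mem_filter]
      constructor
      · intro hm
        rcases lt_trichotomy m q with h | h | h
        · rcases (hlt m h).1 hm with h' | h'
          · exact Or.inl (Or.inl h')
          · omega
        · exact Or.inl (Or.inr h)
        · exact Or.inr ⟨hm, h⟩
      · rintro ((h | rfl) | h)
        · exact (hlt m (hs m h)).2 (Or.inl h)
        · exact hq
        · exact h.1
    refine ⟨⟨heq ▸ x.mem, before_union.2 ⟨fun a ha b hb => ?_, ?_⟩⟩, heq⟩
    · exact (hs a ha).trans (Finset.mem_filter.1 hb).2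
    · exact singleton_before.2 fun a ha => (Finset.mem_filter.1 ha).2
  · have hNq : N ≤ q := by
      by_contra! h
      exact hql.2 ⟨hqn, h⟩
    have heq : x.fin = s ∪ Finset.Ico (n + 1) N ∪ x.fin.filter (q ≤ ·) := by
      ext m
      simp only [Finset.mem_union, Finset.mem_Ico, Finset.mem_filter]
      rcases lt_or_ge m q with h | h
      · rw [hlt m h]
        have : ¬ q ≤ m := h.not_ge
        tauto
      · refine ⟨fun hm => Or.inr ⟨hm, h⟩, ?_⟩
        rintro ((h' | h') | h')
        · have := hs m h'; omega
        · omega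
        · exact h'.1
    have := hF.sperner (u := s ∪ Finset.Ico (n + 1) N) (v := x.fin.filter (q ≤ ·)) ht.1.1
      (heq ▸ x.mem) fun a ha b hb => by
        have := (Finset.mem_filter.1 hb).2
        rcases Finset.mem_union.1 ha with h | h
        · have := hs a h; omega
        · have := (Finset.mem_Ico.1 h).2; omega
    exact absurd (Finset.mem_filter.2 ⟨hq, le_rfl⟩) (this ▸ Finset.notMem_empty q)

variable {k : ℕ}

theorem mem_tail_Ici {s : Finset ℕ} {n : ℕ} :
    n ∈ tail (Set.Ici k) s ↔ k ≤ n ∧ Before s {n} := by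
  rw [before_singleton]; rfl

theorem mem_tail_Ici_of_le {s : Finset ℕ} {n m : ℕ} (hn : n ∈ tail (Set.Ici k) s) (h : n ≤ m) :
    m ∈ tail (Set.Ici k) s :=
  ⟨(Set.mem_Ici.1 hn.1).trans h, fun a ha => (hn.2 a ha).trans_le h⟩

theorem IsStep.isUniform_union {s : Finset ℕ} {β : Ordinal.{0}} {a : ℕ → Ordinal.{0}}
    (ha : IsStep β (tail (Set.Ici k) s) (UnifFam.sec F s) a) {n : ℕ}
    (hn : n ∈ tail (Set.Ici k) s) :
    IsUniform (a n) (tail (Set.Ici k) (s ∪ {n})) (UnifFam.sec F (s ∪ {n})) := by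
  rw [← tail_tail, ← sec_sec (mem_tail_Ici.1 hn).2]
  exact ha.sec n hn

theorem cone_nonempty {M : Set ℕ} {s : Finset ℕ} {β : Ordinal.{0}}
    (h : IsUniform β M (sec F s)) : (cone F s).Nonempty := by
  obtain ⟨x, hx⟩ := h.nonempty
  exact ⟨⟨s ∪ x, hx.1⟩, x, hx, rfl⟩

end Cone

/-! ### Large sup-closed subsets of cones -/

section Large

variable {E : Set ℕ} [WellFoundedLT (LexFam F)]

/-- The members of `F` above `s` that are subsets of `E` contain a cofinal sup-closed set of
order type at least `ω ^ β`. -/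
def Large (F : Set (Finset ℕ)) [WellFoundedLT (LexFam F)] (E : Set ℕ) (s : Finset ℕ)
    (β : Ordinal.{0}) : Prop :=
  ∃ C ⊆ cone F s, (∀ c ∈ C, (c.fin : Set ℕ) ⊆ E) ∧ SupClosed C ∧
    (∀ x ∈ cone F s, ∃ c ∈ C, x ≤ c) ∧ omega0 ^ β ≤ otp C

/-- A block at `n` may reach into the cone at `n + 1`, so blocks are taken at indices at least two
apart. They are then increasing, and cofinal because the indices are unbounded. -/
theorem large_of_blocks {s : Finset ℕ} {β : Ordinal.{0}} (hβ : β ≠ 0) (hsec : ∅ ∉ sec F s)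
    {N : Set ℕ} (hN : N.Infinite) (hsN : ∀ n ∈ N, Before s {n}) {D : ℕ → Set (LexFam F)}
    (hD : ∀ n ∈ N, D n ⊆ cone F (s ∪ {n}) ∪ cone F (s ∪ {n + 1}))
    (hE : ∀ n ∈ N, ∀ x ∈ D n, (x.fin : Set ℕ) ⊆ E) (hsup : ∀ n ∈ N, SupClosed (D n))
    (hmax : ∀ n ∈ N, ∃ m, IsGreatest (D n) m)
    (hotp : ∀ δ < β, ∃ n₀, ∀ n ∈ N, n₀ ≤ n → omega0 ^ δ ≤ otp (D n)) : Large F E s β := by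
  have hsN' : ∀ n ∈ N, Before s {n + 1} := fun n hn => by
    have := hsN n hn
    rw [before_singleton] at *
    exact fun a ha => (this a ha).trans n.lt_succ_self
  -- Every other element of `N`, giving gaps of at least two.
  obtain ⟨u, hu, huN⟩ : ∃ u : ℕ → ℕ, (∀ i j, i < j → u i + 1 < u j) ∧ ∀ i, u i ∈ N := by
    have hmono := Nat.nth_strictMono (p := (· ∈ N)) hN
    refine ⟨fun i => Nat.nth (· ∈ N) (2 * i), fun i j hij => ?_,
      fun i => Nat.nth_mem_of_infinite hN _⟩
    have h1 := hmono (show 2 * i < 2 * i + 1 by omega)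
    have h2 := hmono (show 2 * i + 1 < 2 * j by omega)
    dsimp only
    omega
  have hui : ∀ i, i ≤ u i := by
    intro i
    induction i with
    | zero => exact Nat.zero_le _
    | succ i ih => have := hu i (i + 1) i.lt_succ_self; omega
  have hlt : ∀ i j, i < j → ∀ x ∈ D (u i), ∀ y ∈ D (u j), x < y := by
    intro i j hij x hx y hy
    have huij := hu i j hij
    rcases hD _ (huN i) hx with hx | hx <;> rcases hD _ (huN j) hy with hy | hy
    · exact cone_lt_cone (hsN _ (huN i)) (by omega) hx hy
    · exact cone_lt_cone (hsN _ (huN i)) (by omega) hx hy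
    · exact cone_lt_cone (hsN' _ (huN i)) (by omega) hx hy
    · exact cone_lt_cone (hsN' _ (huN i)) (by omega) hx hy
  refine ⟨⋃ i, D (u i), ?_, ?_, SupClosed.iUnion_blocks (fun i => hsup _ (huN i))
    (fun i => hmax _ (huN i)) hlt, ?_, opow_le_otp_iUnion_blocks hβ ?_ hlt⟩
  · refine Set.iUnion_subset fun i x hx => ?_
    rcases hD _ (huN i) hx with hx | hx
    · exact cone_union_singleton_subset (hsN _ (huN i)) hx
    · exact cone_union_singleton_subset (hsN' _ (huN i)) hx
  · intro x hx
    obtain ⟨i, hi⟩ := Set.mem_iUnion.1 hx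
    exact hE _ (huN i) x hi
  · intro x hx
    obtain ⟨m, hsm, hxm⟩ := exists_mem_cone_union_singleton hsec hx
    obtain ⟨y, hy, -⟩ := hmax _ (huN (m + 1))
    have hm : m < u (m + 1) := hui (m + 1)
    refine ⟨y, Set.mem_iUnion.2 ⟨_, hy⟩, le_of_lt ?_⟩
    rcases hD _ (huN (m + 1)) hy with hy | hy
    · exact cone_lt_cone hsm hm hxm hy
    · exact cone_lt_cone hsm (hm.trans (Nat.lt_succ_self _)) hxm hy
  · intro δ hδ
    obtain ⟨n₀, hn₀⟩ := hotp δ hδ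
    exact ⟨n₀, fun i hi => hn₀ _ (huN i) (hi.trans (hui i))⟩

variable {k : ℕ} {α : Ordinal.{0}}

/-- Largeness of infinitely many immediate successors is inherited if the suprema of the cones
of these successors are subsets of `E`. -/
theorem large_of_children (hF : IsUniform α (Set.Ici k) F) {s : Finset ℕ} {β : Ordinal.{0}}
    {a : ℕ → Ordinal.{0}} (hs : IsUniform β (tail (Set.Ici k) s) (sec F s))
    (ha : IsStep β (tail (Set.Ici k) s) (sec F s) a) {N : Set ℕ} (hN : N.Infinite)
    (hNs : N ⊆ tail (Set.Ici k) s) (hlarge : ∀ n ∈ N, Large F E (s ∪ {n}) (a n))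
    (hfirst : ∀ n ∈ N, ∀ t, IsFirst (sec F s) (n + 1) t → ((s ∪ t : Finset ℕ) : Set ℕ) ⊆ E) :
    Large F E s β := by
  have hex : ∀ n ∈ N, ∃ t, IsFirst (sec F s) (n + 1) t := fun n hn =>
    hs.exists_isFirst fun m hm => mem_tail_Ici_of_le (hNs hn) (n.le_succ.trans hm)
  choose! C hC hCE hCsup hCcof hCotp using hlarge
  choose! t ht using hex
  have hex : ∀ n ∈ N, ∃ l : LexFam F, l.fin = s ∪ t n := fun n hn =>
    ⟨⟨s ∪ t n, (ht n hn).1.1⟩, rfl⟩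
  have : Nonempty (LexFam F) := by
    obtain ⟨n, hn⟩ := hN.nonempty
    exact (hex n hn).nonempty
  choose! l hl using hex
  have hmem : ∀ n ∈ N, l n ∈ cone F (s ∪ {n + 1}) := fun n hn =>
    mem_cone_succ ha.empty_notMem (ht n hn) _ (hl n hn)
  have hlt : ∀ n ∈ N, ∀ c ∈ C n, c < l n := fun n hn c hc =>
    cone_lt_cone (mem_tail_Ici.1 (hNs hn)).2 n.lt_succ_self (hC n hn hc) (hmem n hn)
  refine large_of_blocks (D := fun n => insert (l n) (C n)) (ha.ne_zero hs.infinite)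
    ha.empty_notMem hN (fun n hn => (mem_tail_Ici.1 (hNs hn)).2) ?_ ?_ ?_ ?_ ?_
  · intro n hn
    exact Set.insert_subset (Or.inr (hmem n hn)) fun c hc => Or.inl (hC n hn hc)
  · rintro n hn x (rfl | hx)
    · rw [hl n hn]
      exact hfirst n hn _ (ht n hn)
    · exact hCE n hn x hx
  · intro n hn
    refine (hCsup n hn).insert_sup (hlt n hn) fun x hx => ?_
    obtain ⟨c, hc, hxc⟩ := exists_le_of_lt_first hF (mem_tail_Ici.1 (hNs hn)).2
      (cone_nonempty (ha.isUniform_union (hNs hn))) (ht n hn) _ (hl n hn) hx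
    obtain ⟨d, hd, hcd⟩ := hCcof n hn c hc
    exact ⟨d, hd, hxc.trans hcd⟩
  · intro n hn
    refine ⟨l n, Or.inl rfl, ?_⟩
    rintro x (rfl | hx)
    · exact le_rfl
    · exact (hlt n hn x hx).le
  · intro δ hδ
    obtain ⟨n₀, hn₀⟩ := ha.cof δ hδ
    exact ⟨n₀, fun n hn hle => (Ordinal.opow_le_opow_right Ordinal.omega0_pos
      (hn₀ n (hNs hn) hle)).trans ((hCotp n hn).trans (otp_mono (Set.subset_insert _ _)))⟩

/-! ### Nodes of finite rank and of rank `ω` -/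

theorem infinite_setOf_gt_and {N : Set ℕ} (hN : N.Infinite) {P : ℕ → Prop} (m : ℕ)
    (h : ∀ n ∈ N, m < n → P n) : {n ∈ N | m < n ∧ P n}.Infinite :=
  Set.infinite_of_forall_exists_gt fun p => by
    obtain ⟨n, hn, hlt⟩ := hN.exists_gt (max m p)
    have hm := (le_max_left m p).trans_lt hlt
    exact ⟨n, ⟨hn, hm, h n hn hm⟩, (le_max_right m p).trans_lt hlt⟩

theorem exists_forall_gt_mem_tail (s : Finset ℕ) :
    ∃ m, ∀ n, m < n → n ∈ tail (Set.Ici k) s :=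
  ⟨max k (s.sup id), fun _ hn => ⟨(le_max_left _ _).trans hn.le, fun _ ha =>
    (Finset.le_sup (f := id) ha).trans_lt ((le_max_right _ _).trans_lt hn)⟩⟩

/-- At rank `j + 1` every `t_{n+1}^{F_s}` is an interval of length `j + 1`, so the required suprema
lie in `E` whenever `n, …, n + j + 1` do. -/
theorem large_nat (hF : IsUniform α (Set.Ici k) F)
    (hE : ∀ L : ℕ, {n | ∀ i ≤ L, n + i ∈ E}.Infinite) (j : ℕ) {s : Finset ℕ}
    (hs : IsUniform j (tail (Set.Ici k) s) (sec F s)) (hsE : (s : Set ℕ) ⊆ E) :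
    Large F E s j := by
  induction j generalizing s with
  | zero =>
    rcases hs.eq_zero_or_isStep with ⟨-, h⟩ | ⟨a, ha⟩
    · have hsF : s ∈ F := by
        have : ∅ ∈ sec F s := h ▸ rfl
        simpa using this.1
      have hcone : cone F s = {⟨s, hsF⟩} := by
        ext x
        simp only [cone, h, Set.mem_singleton_iff, exists_eq_left, Finset.union_empty,
          Set.mem_ofPred_eq, LexFam.ext_iff]
      refine ⟨_, hcone.ge, ?_, SupClosed.singleton _, ?_, ?_⟩
      · rintro _ rfl
        exact hsE
      · rw [hcone]
        exact fun x hx => ⟨x, hx, le_rfl⟩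
      · rw [Nat.cast_zero, Ordinal.opow_zero]
        exact one_le_otp (Set.singleton_nonempty _)
    · exact (ha.ne_zero hs.infinite Nat.cast_zero).elim
  | succ j ih =>
    rcases hs.eq_zero_or_isStep with ⟨h, -⟩ | ⟨a, ha⟩
    · exact absurd h (by exact_mod_cast j.succ_ne_zero)
    · obtain ⟨m, hm⟩ := exists_forall_gt_mem_tail (k := k) s
      refine large_of_children hF hs ha (infinite_setOf_gt_and (hE (j + 1)) m fun n _ hn => hm n hn)
        (fun n hn => hn.2.2) ?_ ?_
      · rintro n ⟨hn, -, hnt⟩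
        have haj := ha.succ j (by rw [Nat.cast_succ, Order.succ_eq_add_one]) n hnt
        have hu := ha.isUniform_union hnt
        rw [haj] at hu ⊢
        refine ih hu ?_
        rw [Finset.coe_union, Finset.coe_singleton]
        exact Set.union_subset hsE (Set.singleton_subset_iff.2 (hn 0 (Nat.zero_le _)))
      · rintro n ⟨hn, -, hnt⟩ t ht
        rw [Finset.coe_union]
        refine Set.union_subset hsE fun p hp => ?_
        have hcard := hs.card_eq ht.1
        obtain ⟨N, rfl⟩ := isInit_Ici_iff.1 ht.2
        rw [Nat.card_Ico] at hcard
        rw [Finset.mem_coe, Finset.mem_Ico] at hp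
        have := hn (p - n) (by omega)
        rwa [Nat.add_sub_cancel' (by omega)] at this

/-- The length of `t_{n+1}^{F_s}` now varies with `n`, so these suprema cannot be forced into `E`.
Instead the set of type at least `ω ^ (j + 1)` in the cone at `n` is cut at one of its own points,
keeping type at least `ω ^ j`; the lost exponent does not matter in the limit. -/
theorem large_omega (hF : IsUniform α (Set.Ici k) F)
    (hE : ∀ L : ℕ, {n | ∀ i ≤ L, n + i ∈ E}.Infinite) {s : Finset ℕ}
    (hs : IsUniform omega0 (tail (Set.Ici k) s) (sec F s)) (hsE : (s : Set ℕ) ⊆ E) :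
    Large F E s omega0 := by
  rcases hs.eq_zero_or_isStep with ⟨h, -⟩ | ⟨a, ha⟩
  · exact absurd h Ordinal.omega0_ne_zero
  obtain ⟨m, hm⟩ := exists_forall_gt_mem_tail (k := k) s
  obtain ⟨m', hm'⟩ := ha.cof 1 Ordinal.one_lt_omega0
  -- Only `n ∈ E` is needed here; `1 ≤ a n` makes the finite rank `a n` a successor, leaving room
  -- for the cut.
  have hN := infinite_setOf_gt_and (P := fun n => n ∈ tail (Set.Ici k) s ∧ 1 ≤ a n) (hE 0)
    (max m m') fun n _ hn => by
      have hn' := hm n ((le_max_left _ _).trans_lt hn)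
      exact ⟨hn', hm' n hn' ((le_max_right _ _).trans hn.le)⟩
  have hblock : ∀ n ∈ {n ∈ {n | ∀ i ≤ 0, n + i ∈ E} |
      max m m' < n ∧ n ∈ tail (Set.Ici k) s ∧ 1 ≤ a n}, ∃ D ⊆ cone F (s ∪ {n}),
      (∀ c ∈ D, (c.fin : Set ℕ) ⊆ E) ∧ SupClosed D ∧ (∃ d, IsGreatest D d) ∧
      ∀ δ, δ + 1 ≤ a n → omega0 ^ δ ≤ otp D := by
    rintro n ⟨hn, -, hnt, h1⟩
    obtain ⟨j, hj⟩ := Ordinal.lt_omega0.1 (ha.lt n hnt)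
    have hu := ha.isUniform_union hnt
    rw [hj] at hu h1
    obtain ⟨j, rfl⟩ := Nat.exists_eq_succ_of_ne_zero
      (Nat.one_le_iff_ne_zero.1 (by exact_mod_cast h1))
    obtain ⟨C, hC, hCE, hCsup, -, hCotp⟩ := large_nat hF hE _ hu (by
      rw [Finset.coe_union, Finset.coe_singleton]
      exact Set.union_subset hsE (Set.singleton_subset_iff.2 (hn 0 (Nat.zero_le _))))
    have hlt : omega0 ^ (j : Ordinal) < otp C := lt_of_lt_of_le
      ((Ordinal.opow_lt_opow_iff_right Ordinal.one_lt_omega0).2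
        (by exact_mod_cast j.lt_succ_self)) hCotp
    obtain ⟨c, hc, hotp⟩ := exists_le_otp_inter_Iic hlt
    refine ⟨C ∩ Set.Iic c, fun x hx => hC hx.1, fun x hx => hCE x hx.1, hCsup.inter_Iic c,
      ⟨c, ⟨hc, Set.mem_Iic.2 le_rfl⟩, fun x hx => hx.2⟩, fun δ hδ => ?_⟩
    rw [hj, Nat.cast_succ, ← Order.succ_eq_add_one, ← Order.succ_eq_add_one,
      Order.succ_le_succ_iff] at hδ
    exact (Ordinal.opow_le_opow_right Ordinal.omega0_pos hδ).trans hotp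
  choose! D hD hDE hDsup hDmax hDotp using hblock
  refine large_of_blocks (D := D) Ordinal.omega0_ne_zero ha.empty_notMem hN
    (fun n hn => (mem_tail_Ici.1 hn.2.2.1).2)
    (fun n hn => (hD n hn).trans Set.subset_union_left) hDE hDsup hDmax fun δ hδ => ?_
  obtain ⟨n₀, hn₀⟩ := ha.cof (δ + 1) (Ordinal.isSuccLimit_omega0.add_one_lt hδ)
  exact ⟨n₀, fun n hn hle => hDotp n hn δ (hn₀ n hn.2.2.1 hle)⟩

end Large

/-! ### Trees -/

section Tree

variable {k : ℕ} {α : Ordinal.{0}} {T : Set (Finset ℕ)}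

theorem IsInit.subset {s : Finset ℕ} {A : Set ℕ} (h : IsInit s A) : (s : Set ℕ) ⊆ A := by
  obtain ⟨n, hn⟩ := h
  exact fun x hx => (hn.subset hx).1

theorem subset_treeSet (hT : IsTree (Set.Ici k) F T) {s : Finset ℕ} (hs : s ∈ T) :
    (s : Set ℕ) ⊆ treeSet F T := by
  intro m hm
  refine ⟨s.filter (· < m), m, before_singleton.2 fun a ha => (Finset.mem_filter.1 ha).2,
    hT.init_mem s hs _ ⟨m + 1, ?_⟩, Or.inl rfl⟩
  ext p
  simp only [Finset.coe_union, Finset.coe_singleton, Set.mem_union, Set.mem_singleton_iff,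
    Finset.mem_coe, Finset.mem_filter, Set.mem_ofPred_eq]
  constructor
  · rintro (h | rfl)
    · exact ⟨h.1, by omega⟩
    · exact ⟨hm, by omega⟩
  · rintro ⟨h, h'⟩
    rcases (Nat.lt_succ_iff.1 h').eq_or_lt with h' | h'
    · exact Or.inr h'
    · exact Or.inl ⟨h, h'⟩

/-- A node of `T` is an initial segment of a member of `F`. -/
theorem exists_superset_of_mem_tree (hT : IsTree (Set.Ici k) F T) {s : Finset ℕ} (hs : s ∈ T) :
    ∃ t ∈ F, s ⊆ t ∧ ∀ x ∈ t, ∀ a ∈ s, x ≤ a → x ∈ s := by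
  obtain ⟨u, ⟨⟨t, ht, q, hq⟩, -⟩, p, hp⟩ := hT.subset hs
  simp only [Set.ext_iff, Finset.mem_coe, Set.mem_ofPred_eq] at hp hq
  refine ⟨t, ht, fun x hx => ((hq x).1 ((hp x).1 hx).1).1, fun x hx a ha hxa => ?_⟩
  have ha := (hp a).1 ha
  exact (hp x).2 ⟨(hq x).2 ⟨hx, hxa.trans_lt ((hq a).1 ha.1).2⟩, hxa.trans_lt ha.2⟩

theorem IsUniform.subset {β M G} (h : IsUniform β M G) {s : Finset ℕ} (hs : s ∈ G) :
    (s : Set ℕ) ⊆ M := by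
  rcases h.eq_zero_or_isStep with ⟨-, rfl⟩ | ⟨a, ha⟩
  · rw [Set.mem_singleton_iff.1 hs]
    simp
  · exact ha.subset s hs

/-- The immediate successors of a node of `T`. -/
def succs (T : Set (Finset ℕ)) (s : Finset ℕ) : Set ℕ := {n | Before s {n} ∧ s ∪ {n} ∈ T}

theorem succs_subset_tail (hF : IsUniform α (Set.Ici k) F) (hT : IsTree (Set.Ici k) F T)
    {s : Finset ℕ} : succs T s ⊆ tail (Set.Ici k) s := by
  rintro n ⟨hn, hnT⟩
  obtain ⟨t, ht, hst, -⟩ := exists_superset_of_mem_tree hT hnT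
  exact mem_tail_Ici.2 ⟨hF.subset ht (hst (by simp)), hn⟩

theorem omegaNodes_or_succs_infinite (hT : IsTree (Set.Ici k) F T) {s : Finset ℕ} (hs : s ∈ T) :
    IsUniform omega0 (tail (Set.Ici k) s) (sec F s) ∨ (succs T s).Infinite := by
  by_cases h : s ∈ terminal T
  · exact Or.inl (hT.terminal_subset h).2
  · exact Or.inr (hT.infinite_succ s ⟨hs, h⟩)

/-- Otherwise `s ∈ F` would be a proper initial segment of the member of `F` extending `s ∪ {n}`. -/
theorem empty_notMem_sec_of_succs (hF : IsUniform α (Set.Ici k) F) (hT : IsTree (Set.Ici k) F T)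
    {s : Finset ℕ} (hs : (succs T s).Nonempty) : ∅ ∉ sec F s := by
  intro h
  obtain ⟨n, hn, hnT⟩ := hs
  rw [before_singleton] at hn
  obtain ⟨t, ht, hst, hinit⟩ := exists_superset_of_mem_tree hT hnT
  have hst' : s ⊆ t := Finset.subset_union_left.trans hst
  have hempty := hF.sperner (u := s) (v := t \ s) (by simpa using h.1)
    (by rwa [Finset.union_sdiff_of_subset hst']) fun a ha b hb => by
      obtain ⟨hbt, hbs⟩ := Finset.mem_sdiff.1 hb
      by_contra! hba
      rcases Finset.mem_union.1 (hinit b hbt a (Finset.mem_union_left _ ha) hba) with h | h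
      · exact hbs h
      · rw [Finset.mem_singleton.1 h] at hba
        exact (hn a ha).not_ge hba
  have : n ∈ t \ s :=
    Finset.mem_sdiff.2 ⟨hst (by simp), fun h => (hn n h).false⟩
  rw [hempty] at this
  exact Finset.notMem_empty n this

theorem exists_isStep_of_succs (hF : IsUniform α (Set.Ici k) F) (hT : IsTree (Set.Ici k) F T)
    {s : Finset ℕ} {β : Ordinal.{0}} (hu : IsUniform β (tail (Set.Ici k) s) (sec F s))
    (hs : (succs T s).Nonempty) : ∃ a, IsStep β (tail (Set.Ici k) s) (sec F s) a := by
  rcases hu.eq_zero_or_isStep with ⟨-, h⟩ | h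
  · exact (empty_notMem_sec_of_succs hF hT hs (h ▸ rfl)).elim
  · exact h

theorem isFirst_subset_treeSet {s t : Finset ℕ} {n : ℕ} (hn : n ∈ succs T s)
    (ht : IsFirst (sec F s) (n + 1) t) : (t : Set ℕ) ⊆ treeSet F T :=
  fun _ hm => ⟨s, n, hn.1, hn.2, Or.inr ⟨t, ht, hm⟩⟩

open Ordinal in
/-- Below a node of rank at least `ω + ω`, the set `E(T)` contains arbitrarily long intervals. -/
theorem infinite_intervals (hF : IsUniform α (Set.Ici k) F) (hT : IsTree (Set.Ici k) F T)
    {β : Ordinal.{0}} {s : Finset ℕ} (hs : s ∈ T)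
    (hu : IsUniform β (tail (Set.Ici k) s) (sec F s)) (hβ : omega0 + omega0 ≤ β) (L : ℕ) :
    {n | ∀ i ≤ L, n + i ∈ treeSet F T}.Infinite := by
  induction β using WellFoundedLT.induction generalizing s with
  | ind β ih =>
  have hinf : (succs T s).Infinite := by
    rcases omegaNodes_or_succs_infinite hT hs with h | h
    · rw [hu.unique h] at hβ
      exact absurd hβ (lt_add_of_pos_right _ omega0_pos).not_ge
    · exact h
  obtain ⟨a, ha⟩ := exists_isStep_of_succs hF hT hu hinf.nonempty
  have hsub := succs_subset_tail hF hT (s := s)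
  -- Descend in the tree while the rank stays at least `ω + ω`; where this stops, the rank is
  -- exactly `ω + ω`.
  by_cases hbig : ∃ n ∈ succs T s, omega0 + omega0 ≤ a n
  · obtain ⟨n, hn, hle⟩ := hbig
    exact ih _ (ha.lt n (hsub hn)) hn.2 (ha.isUniform_union (hsub hn)) hle
  push Not at hbig
  obtain rfl : β = omega0 + omega0 := by
    refine le_antisymm ?_ hβ
    by_contra! hlt
    obtain ⟨n₀, hn₀⟩ := ha.cof _ hlt
    obtain ⟨n, hn, hle⟩ := hinf.exists_gt n₀
    exact (hbig n hn).not_ge (hn₀ n (hsub hn) hle.le)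
  obtain ⟨n₀, hn₀⟩ := ha.cof (omega0 + L) ((add_lt_add_iff_left _).2 (natCast_lt_omega0 L))
  refine (infinite_setOf_gt_and hinf n₀ (P := fun n => ∀ i ≤ L, n + i ∈ treeSet F T) ?_).mono
    fun n hn => hn.2.2
  intro n hn hle
  obtain ⟨t, ht⟩ := hu.exists_isFirst (n := n + 1) fun m hm =>
    mem_tail_Ici_of_le (hsub hn) (n.le_succ.trans hm)
  -- The least element `p` of `t` exceeds `n₀`, so the section at `p` has rank `ω + j` with `j`
  -- finite and `j ≥ L`.
  have hcard : L ≤ t.card := by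
    obtain ⟨p, hp, v, hv, rfl⟩ := ha.exists_cons ht.1
    have hnp : n + 1 ≤ p := ht.2.subset (show p ∈ (({p} ∪ v : Finset ℕ) : Set ℕ) by simp)
    have hap := hn₀ p hp (by omega)
    obtain ⟨γ, hγ⟩ := exists_add_of_le (le_self_add.trans hap)
    have hlt := ha.lt p hp
    rw [hγ] at hlt hap
    obtain ⟨j, rfl⟩ := lt_omega0.1 ((add_lt_add_iff_left _).1 hlt)
    have hj : L ≤ j := by exact_mod_cast (add_le_add_iff_left _).1 hap
    have hup := ha.sec p hp
    rw [hγ] at hup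
    rw [card_cons hv.2]
    exact hj.trans ((hup.le_card hv).trans (Nat.le_succ _))
  obtain ⟨N, rfl⟩ := isInit_Ici_iff.1 ht.2
  rw [Nat.card_Ico] at hcard
  intro i hi
  rcases i.eq_zero_or_pos with rfl | hi0
  · exact ⟨s, n, hn.1, hn.2, Or.inl rfl⟩
  · exact isFirst_subset_treeSet hn ht (Finset.mem_coe.2 (Finset.mem_Ico.2 ⟨by omega, by omega⟩))

/-- Terminal nodes have rank `ω`. At every other node of rank different from `ω`, `E(T)` contains
both `s` and `t_{n+1}^{F_s}` for all successors `n`, which is what `large_of_children` needs. -/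
theorem large_of_mem_tree [WellFoundedLT (LexFam F)] (hF : IsUniform α (Set.Ici k) F)
    (hT : IsTree (Set.Ici k) F T)
    (hE : ∀ L : ℕ, {n | ∀ i ≤ L, n + i ∈ treeSet F T}.Infinite) {β : Ordinal.{0}}
    {s : Finset ℕ} (hs : s ∈ T) (hu : IsUniform β (tail (Set.Ici k) s) (sec F s)) :
    Large F (treeSet F T) s β := by
  induction β using WellFoundedLT.induction generalizing s with
  | ind β ih =>
  rcases omegaNodes_or_succs_infinite hT hs with h | hinf
  · obtain rfl := hu.unique h
    exact large_omega hF hE hu (subset_treeSet hT hs)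
  · obtain ⟨a, ha⟩ := exists_isStep_of_succs hF hT hu hinf.nonempty
    have hsub := succs_subset_tail hF hT (s := s)
    refine large_of_children hF hu ha hinf hsub
      (fun n hn => ih _ (ha.lt n (hsub hn)) hn.2 (ha.isUniform_union (hsub hn)))
      fun n hn t ht => ?_
    rw [Finset.coe_union]
    exact Set.union_subset (subset_treeSet hT hs) (isFirst_subset_treeSet hn ht)

/-- Write `α = ω + γ`; if `α < ω + ω`, then `γ < ω < α`, a forbidden decomposition. -/
theorem IsIndecomposable.omega_add_omega_le (hα : omega0 < α) (hind : IsIndecomposable α) :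
    omega0 + omega0 ≤ α := by
  by_contra! hlt
  obtain ⟨γ, rfl⟩ := exists_add_of_le hα.le
  exact hind ⟨_, _, hα, ((add_lt_add_iff_left _).1 hlt).trans hα, rfl⟩

end Tree

end UnifFam

theorem mainTheorem4 (k : ℕ) (α : Ordinal.{0}) (F T : Set (Finset ℕ))
    (hα : Ordinal.omega0 < α) (hind : UnifFam.IsIndecomposable α)
    (hF : UnifFam.IsUniform α (Set.Ici k) F) (hT : UnifFam.IsTree (Set.Ici k) F T) :
    UnifFam.ContainsCopy F (UnifFam.restrict F (UnifFam.treeSet F T)) := by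
  have := hF.wellFoundedLT
  have hroot : ∅ ∈ T := by
    obtain ⟨t, ht⟩ := hT.nonempty
    exact hT.init_mem t ht ∅ ⟨0, by simp⟩
  have hu : UnifFam.IsUniform α (UnifFam.tail (Set.Ici k) ∅) (UnifFam.sec F ∅) := by
    have htail : UnifFam.tail (Set.Ici k) ∅ = Set.Ici k := by ext; simp [UnifFam.tail]
    have hsec : UnifFam.sec F ∅ = F := by ext; simp [UnifFam.sec, UnifFam.Before]
    rwa [htail, hsec]
  obtain ⟨C, -, hCE, hC, -, hotp⟩ := UnifFam.large_of_mem_tree hF hT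
    (UnifFam.infinite_intervals hF hT hroot hu (hind.omega_add_omega_le hα)) hroot hu
  obtain ⟨f, hf, hfC⟩ := UnifFam.exists_isEmbedding_of_supClosed hC (hF.type_le.trans hotp)
  exact UnifFam.containsCopy_of_isEmbedding f hf fun x => ⟨(f x).mem, hCE _ (hfC x)⟩
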